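/- All graphs are simple. The Cartesian product $G\Box H$ and the strong product $G\boxtimes H$ both have vertex set $V(G)\times V(H)$. In $G\Box H$, $(g,h)$ and $(g',h')$ are adjacent iff $g=g'$ and $hh'\in E(H)$, or $gg'\in E(G)$ and $h=h'$; and $E(G\boxtimes H)=E(G\Box H)\cup\{(g,h)(g',h') : gg'\in E(G),\ hh'\in E(H)\}$. The distinguishing index $D'(G)$ is the least integer $d\ge 1$ such that the edges of $G$ can be labeled with $d$ labels so that only the identity automorphism of $G$ preserves all edge labels (and $D'(G)=\infty$ if no such $d$ exists, as for $G=K_2$). A graph is $S$-thin if no two distinct vertices $x,y$ have equal closed neighborhoods $N[x]=N[y]$. A graph is prime (with respect to the strong product) if it has at least two vertices and is not isomorphic to a strong product $G_1\boxtimes G_2$ of two graphs that each have at least two vertices. (i) If $G$ and $H$ are connected graphs, then $D'(G\boxtimes H)\le D'(G\Box H)+1$. (ii) If $G$ and $H$ are finite connected graphs that are $S$-thin and prime with respect to the strong product, then $D'(G\boxtimes H)\le D'(G\Box H)$. -/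

import Mathlib

universe u v

namespace SimpleGraph

/-- The direct product `G × H`: `(g, h)` and `(g', h')` are adjacent iff
`g g'` is an edge of `G` and `h h'` is an edge of `H`. -/
def directProd {V : Type u} {W : Type v} (G : SimpleGraph V) (H : SimpleGraph W) :
    SimpleGraph (V × W) where
  Adj x y := G.Adj x.1 y.1 ∧ H.Adj x.2 y.2
  symm := ⟨fun _ _ h => ⟨h.1.symm, h.2.symm⟩⟩
  loopless := ⟨fun _ h => G.irrefl h.1⟩

/-- The strong product `G ⊠ H`, whose edge set is the union of the edge sets of the Cartesian
product `G □ H` (Mathlib's box product) and of the direct product. -/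
def strongProd {V : Type u} {W : Type v} (G : SimpleGraph V) (H : SimpleGraph W) :
    SimpleGraph (V × W) :=
  (G □ H) ⊔ directProd G H

/-- The closed neighborhood `N[x]`. -/
def closedNbhd {V : Type u} (G : SimpleGraph V) (x : V) : Set V :=
  insert x (G.neighborSet x)

/-- A graph is `S`-thin if no two distinct vertices have the same closed neighborhood. -/
def IsSThin {V : Type u} (G : SimpleGraph V) : Prop :=
  ∀ x y : V, G.closedNbhd x = G.closedNbhd y → x = y

/-- A graph is prime with respect to the strong product if it is nontrivial (it has at least two
vertices) and it is not isomorphic to the strong product of two nontrivial graphs. -/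
def IsStrongPrime {V : Type u} (G : SimpleGraph V) : Prop :=
  Nontrivial V ∧
    ¬ ∃ (A B : Type u) (G₁ : SimpleGraph A) (G₂ : SimpleGraph B),
        Nontrivial A ∧ Nontrivial B ∧ Nonempty (G ≃g strongProd G₁ G₂)

/-- An edge labeling is distinguishing if the identity is the only automorphism that preserves
the label of every edge. -/
def IsEdgeDistinguishing {V : Type u} (G : SimpleGraph V) {d : ℕ} (c : G.edgeSet → Fin d) :
    Prop :=
  ∀ φ : G ≃g G, (∀ e : G.edgeSet, c (φ.mapEdgeSet e) = c e) → ∀ x : V, φ x = x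

/-- The distinguishing index `D'(G)`: the least positive integer `d` for which `G` has a
distinguishing edge labeling with `d` labels, and `⊤` if there is no such `d`
(as for the complete graph on two vertices). -/
noncomputable def distinguishingIndex {V : Type u} (G : SimpleGraph V) : ℕ∞ :=
  sInf {n : ℕ∞ | ∃ d : ℕ, 1 ≤ d ∧ n = (d : ℕ∞) ∧
    ∃ c : G.edgeSet → Fin d, G.IsEdgeDistinguishing c}

end SimpleGraph

/-! Both bounds extend a distinguishing labeling of `G □ H` to `G.strongProd H`. An automorphism
that preserves the Cartesian edges and all labels is then trivial. For (i), a fresh label marks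
exactly the other edges, so preserving labels forces preserving `G □ H`.

For (ii), every automorphism already preserves `G □ H` (`boxProd_adj_map_of_prime`). The Cartesian
skeleton is built from closed neighborhoods alone, so it is invariant; for `S`-thin factors it is
the Cartesian product of the factor skeletons, which are connected. By additivity of distances, the
image of a fiber is a box, closed under mixing coordinates (`exists_boxProd_iso_corner`). A box
induces a strong product of its projections, so primeness puts it in one fiber
(`IsStrongPrime.const_of_box`). -/

namespace SimpleGraph

/-! ### Cartesian skeletons of neighborhood families -/

section Skeleton

variable {V W α β : Type*}

/-- `HalfDispensable N x y z` says that `z` witnesses one of the two symmetric conditions for the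
pair `x y` to be left out of the Cartesian skeleton of the family of neighborhoods `N`. -/
def HalfDispensable (N : V → Set α) (x y z : V) : Prop :=
  N x ∩ N y ⊂ N x ∩ N z ∨ (N x ⊂ N z ∧ N z ⊂ N y)

/-- The Cartesian skeleton of a family of neighborhoods: two vertices with intersecting
neighborhoods are adjacent unless the pair is dispensable. -/
def cartesianSkeleton (N : V → Set α) : SimpleGraph V where
  Adj x y := x ≠ y ∧ (N x ∩ N y).Nonempty ∧
    ¬ ∃ z, HalfDispensable N x y z ∧ HalfDispensable N y x z
  symm := ⟨fun x y ⟨h₁, h₂, h₃⟩ =>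
    ⟨h₁.symm, Set.inter_comm (N x) (N y) ▸ h₂, fun ⟨z, hz⟩ => h₃ ⟨z, hz.2, hz.1⟩⟩⟩
  loopless := ⟨fun _ h => h.1 rfl⟩

theorem cartesianSkeleton_adj {N : V → Set α} {x y : V} :
    (cartesianSkeleton N).Adj x y ↔ x ≠ y ∧ (N x ∩ N y).Nonempty ∧
      ¬ ∃ z, HalfDispensable N x y z ∧ HalfDispensable N y x z :=
  Iff.rfl

theorem halfDispensable_map {N : V → Set α} {M : W → Set β} (f : V ≃ W) (e : α ≃ β)
    (h : ∀ x, M (f x) = e '' N x) (x y z : V) :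
    HalfDispensable M (f x) (f y) (f z) ↔ HalfDispensable N x y z := by
  simp only [HalfDispensable, h, ← Set.image_inter e.injective,
    Set.ssubset_def, Set.image_subset_image_iff e.injective]

/-- The Cartesian skeleton is natural in bijections. -/
def cartesianSkeletonIso {N : V → Set α} {M : W → Set β} (f : V ≃ W) (e : α ≃ β)
    (h : ∀ x, M (f x) = e '' N x) : cartesianSkeleton N ≃g cartesianSkeleton M where
  toEquiv := f
  map_rel_iff' := by
    intro x y
    simp only [cartesianSkeleton_adj, f.surjective.exists, halfDispensable_map f e h, h,
      ← Set.image_inter e.injective, Set.image_nonempty, ne_eq, f.injective.eq_iff]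

/-- The family of products of neighborhoods. -/
def prodNbhd (N : V → Set α) (M : W → Set β) (x : V × W) : Set (α × β) :=
  N x.1 ×ˢ M x.2

theorem prod_ssubset_prod_left {s t : Set α} {u : Set β} (hu : u.Nonempty) :
    s ×ˢ u ⊂ t ×ˢ u ↔ s ⊂ t := by
  simp only [Set.ssubset_def, Set.prod_subset_prod_iff_left hu]

theorem prod_ssubset_prod_right {s t : Set β} {u : Set α} (hu : u.Nonempty) :
    u ×ˢ s ⊂ u ×ˢ t ↔ s ⊂ t := by
  simp only [Set.ssubset_def, Set.prod_subset_prod_iff_right hu]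

variable {N : V → Set α} {M : W → Set β}

/-- If `N g ⊄ N g'`, replacing `g'` by `g` strictly enlarges the intersection; otherwise both
inclusions are strict and the corner lies strictly between. -/
theorem halfDispensable_prod_corner_left (hN : ∀ x, (N x).Nonempty) (hM : ∀ x, (M x).Nonempty)
    {g g' : V} {h h' : W} (hi : (M h ∩ M h').Nonempty)
    (hg : ¬ (N g ⊆ N g' ∧ N g' ⊆ N g)) (hh : ¬ (M h ⊆ M h' ∧ M h' ⊆ M h))
    (H : ¬ N g ⊆ N g' ∨ M h ⊆ M h') :
    HalfDispensable (prodNbhd N M) (g, h) (g', h') (g, h') := by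
  by_cases hs : N g ⊆ N g'
  · have hr : M h ⊆ M h' := H.resolve_left (not_not.2 hs)
    right
    simp only [prodNbhd]
    exact ⟨(prod_ssubset_prod_right (hN g)).2 ⟨hr, fun k => hh ⟨hr, k⟩⟩,
      (prod_ssubset_prod_left (hM h')).2 ⟨hs, fun k => hg ⟨hs, k⟩⟩⟩
  · left
    simp only [prodNbhd, Set.prod_inter_prod, Set.inter_self]
    refine (prod_ssubset_prod_left hi).2 ⟨Set.inter_subset_left, fun k => hs ?_⟩
    exact fun a ha => (k ha).2

theorem halfDispensable_prod_corner_right (hN : ∀ x, (N x).Nonempty) (hM : ∀ x, (M x).Nonempty)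
    {g g' : V} {h h' : W} (hi : (N g ∩ N g').Nonempty)
    (hg : ¬ (N g ⊆ N g' ∧ N g' ⊆ N g)) (hh : ¬ (M h ⊆ M h' ∧ M h' ⊆ M h))
    (H : ¬ M h ⊆ M h' ∨ N g ⊆ N g') :
    HalfDispensable (prodNbhd N M) (g, h) (g', h') (g', h) := by
  by_cases hs : M h ⊆ M h'
  · have hr : N g ⊆ N g' := H.resolve_left (not_not.2 hs)
    right
    simp only [prodNbhd]
    exact ⟨(prod_ssubset_prod_left (hM h)).2 ⟨hr, fun k => hg ⟨hr, k⟩⟩,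
      (prod_ssubset_prod_right (hN g')).2 ⟨hs, fun k => hh ⟨hs, k⟩⟩⟩
  · left
    simp only [prodNbhd, Set.prod_inter_prod, Set.inter_self]
    refine (prod_ssubset_prod_right hi).2 ⟨Set.inter_subset_left, fun k => hs ?_⟩
    exact fun a ha => (k ha).2

theorem cartesianSkeleton_prodNbhd_coord_eq (hN : ∀ x, (N x).Nonempty)
    (hM : ∀ x, (M x).Nonempty) (iN : Function.Injective N) (iM : Function.Injective M)
    {x y : V × W} (hxy : (cartesianSkeleton (prodNbhd N M)).Adj x y) : x.1 = y.1 ∨ x.2 = y.2 := by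
  obtain ⟨g, h⟩ := x
  obtain ⟨g', h'⟩ := y
  obtain ⟨-, hi, hd⟩ := hxy
  simp only [prodNbhd, Set.prod_inter_prod, Set.prod_nonempty_iff] at hi
  by_contra! hne
  have hg : ¬ (N g ⊆ N g' ∧ N g' ⊆ N g) := fun k => hne.1 (iN (k.1.antisymm k.2))
  have hh : ¬ (M h ⊆ M h' ∧ M h' ⊆ M h) := fun k => hne.2 (iM (k.1.antisymm k.2))
  have hi1 : (N g' ∩ N g).Nonempty := Set.inter_comm (N g) (N g') ▸ hi.1
  have hi2 : (M h' ∩ M h).Nonempty := Set.inter_comm (M h) (M h') ▸ hi.2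
  -- One of the two remaining corners witnesses dispensability. If `(g, h')` fails, one factor has
  -- an inclusion that the other lacks, and this makes `(g', h)` work.
  by_cases c : (¬ N g ⊆ N g' ∨ M h ⊆ M h') ∧ (¬ M h' ⊆ M h ∨ N g' ⊆ N g)
  · exact hd ⟨(g, h'), halfDispensable_prod_corner_left hN hM hi.2 hg hh c.1,
      halfDispensable_prod_corner_right hN hM hi1 (by tauto) (by tauto) c.2⟩
  · exact hd ⟨(g', h), halfDispensable_prod_corner_right hN hM hi.1 hg hh (by tauto),
      halfDispensable_prod_corner_left hN hM hi2 (by tauto) (by tauto) (by tauto)⟩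

theorem HalfDispensable.prod_left (hM : ∀ x, (M x).Nonempty) {g g' z : V}
    (H : HalfDispensable N g g' z) (h : W) :
    HalfDispensable (prodNbhd N M) (g, h) (g', h) (z, h) := by
  simpa only [HalfDispensable, prodNbhd, Set.prod_inter_prod, Set.inter_self,
    prod_ssubset_prod_left (hM h)] using H

/-- The inclusions force the second factors on both sides to coincide, so they cancel. -/
theorem HalfDispensable.of_prod_left (hN : ∀ x, (N x).Nonempty) (hM : ∀ x, (M x).Nonempty)
    {g g' : V} {h : W} {z : V × W} (hi : (N g ∩ N g').Nonempty)
    (H : HalfDispensable (prodNbhd N M) (g, h) (g', h) z) : HalfDispensable N g g' z.1 := by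
  rcases H with H | ⟨H₁, H₂⟩
  · left
    simp only [prodNbhd, Set.prod_inter_prod, Set.inter_self] at H
    have hs := (Set.prod_subset_prod_iff' (hi.prod (hM h))).1 H.1
    rw [hs.2.antisymm Set.inter_subset_left |>.symm] at H
    exact (prod_ssubset_prod_left (hM h)).1 H
  · right
    simp only [prodNbhd] at H₁ H₂
    have k₁ := (Set.prod_subset_prod_iff' ((hN g).prod (hM h))).1 H₁.1
    have k₂ := (Set.prod_subset_prod_iff' ((hN z.1).prod (hM z.2))).1 H₂.1
    rw [k₂.2.antisymm k₁.2] at H₁ H₂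
    exact ⟨(prod_ssubset_prod_left (hM h)).1 H₁, (prod_ssubset_prod_left (hM h)).1 H₂⟩

theorem cartesianSkeleton_prodNbhd_adj_left (hN : ∀ x, (N x).Nonempty)
    (hM : ∀ x, (M x).Nonempty) {g g' : V} {h : W} :
    (cartesianSkeleton (prodNbhd N M)).Adj (g, h) (g', h) ↔ (cartesianSkeleton N).Adj g g' := by
  simp only [cartesianSkeleton_adj]
  have hi : (prodNbhd N M (g, h) ∩ prodNbhd N M (g', h)).Nonempty ↔ (N g ∩ N g').Nonempty := by
    simp [prodNbhd, Set.prod_inter_prod, Set.prod_nonempty_iff, hM h]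
  rw [hi]
  refine and_congr (by simp) (and_congr_right fun hi => not_congr ⟨?_, ?_⟩)
  · rintro ⟨z, h₁, h₂⟩
    exact ⟨z.1, h₁.of_prod_left hN hM hi,
      h₂.of_prod_left hN hM (Set.inter_comm (N g) (N g') ▸ hi)⟩
  · rintro ⟨z, h₁, h₂⟩
    exact ⟨(z, h), h₁.prod_left hM h, h₂.prod_left hM h⟩

/-- Exchanging the two coordinates of a product of neighborhood families. -/
def cartesianSkeletonProdComm (N : V → Set α) (M : W → Set β) :
    cartesianSkeleton (prodNbhd N M) ≃g cartesianSkeleton (prodNbhd M N) :=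
  cartesianSkeletonIso (Equiv.prodComm V W) (Equiv.prodComm α β) fun x => by
    simp [prodNbhd]

theorem cartesianSkeleton_prodNbhd_adj_right (hN : ∀ x, (N x).Nonempty)
    (hM : ∀ x, (M x).Nonempty) {g : V} {h h' : W} :
    (cartesianSkeleton (prodNbhd N M)).Adj (g, h) (g, h') ↔ (cartesianSkeleton M).Adj h h' := by
  rw [← cartesianSkeleton_prodNbhd_adj_left (M := N) hM hN (h := g)]
  exact ((cartesianSkeletonProdComm N M).map_rel_iff' (a := (g, h)) (b := (g, h'))).symm

/-- The Cartesian skeleton of a product family is the Cartesian product of the skeletons. -/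
theorem cartesianSkeleton_prodNbhd (hN : ∀ x, (N x).Nonempty)
    (hM : ∀ x, (M x).Nonempty) (iN : Function.Injective N) (iM : Function.Injective M) :
    cartesianSkeleton (prodNbhd N M) = cartesianSkeleton N □ cartesianSkeleton M := by
  ext ⟨g, h⟩ ⟨g', h'⟩
  rw [boxProd_adj]
  constructor
  · intro k
    rcases cartesianSkeleton_prodNbhd_coord_eq hN hM iN iM k with e | e <;>
      simp only at e <;> subst e
    · exact Or.inr ⟨(cartesianSkeleton_prodNbhd_adj_right hN hM).1 k, rfl⟩
    · exact Or.inl ⟨(cartesianSkeleton_prodNbhd_adj_left hN hM).1 k, rfl⟩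
  · rintro (⟨k, e⟩ | ⟨k, e⟩) <;> simp only at e k <;> subst e
    · exact (cartesianSkeleton_prodNbhd_adj_left hN hM).2 k
    · exact (cartesianSkeleton_prodNbhd_adj_right hN hM).2 k

theorem cartesianSkeleton_reachable_of_ssubset [Finite α] (hN : ∀ x, (N x).Nonempty) (y : V) :
    ∀ x, N x ⊂ N y → (cartesianSkeleton N).Reachable x y := by
  intro x
  induction hn : (N y \ N x).ncard using Nat.strong_induction_on generalizing x y with
  | _ n ih =>
  intro hxy
  by_cases hz : ∃ z, N x ⊂ N z ∧ N z ⊂ N y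
  · obtain ⟨z, h₁, h₂⟩ := hz
    have l₁ : (N z \ N x).ncard < n := by
      rw [← hn]
      obtain ⟨a, ha, ha'⟩ := Set.exists_of_ssubset h₂
      exact Set.ncard_lt_ncard ⟨Set.sdiff_subset_sdiff_left h₂.1,
        fun k => ha' (k ⟨ha, fun q => ha' (h₁.1 q)⟩).1⟩ (Set.toFinite _)
    have l₂ : (N y \ N z).ncard < n := by
      rw [← hn]
      obtain ⟨a, ha, ha'⟩ := Set.exists_of_ssubset h₁
      exact Set.ncard_lt_ncard ⟨Set.sdiff_subset_sdiff_right h₁.1,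
        fun k => (k ⟨h₂.1 ha, ha'⟩).2 ha⟩ (Set.toFinite _)
    exact (ih _ l₁ z x rfl h₁).trans (ih _ l₂ y z rfl h₂)
  -- With nothing strictly between, the pair is an edge: `N x ∩ N y = N x` cannot grow.
  · refine Adj.reachable ⟨fun e => hxy.ne (e ▸ rfl), ?_, ?_⟩
    · rw [Set.inter_eq_left.2 hxy.1]
      exact hN x
    · rintro ⟨z, h₁ | h₁, -⟩
      · rw [Set.inter_eq_left.2 hxy.1] at h₁
        exact h₁.not_subset Set.inter_subset_left
      · exact hz ⟨z, h₁⟩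

/-- Induction towards larger intersections: a dispensable pair either has nested neighborhoods or a
`z` meeting each of `x`, `y` in more. -/
theorem cartesianSkeleton_reachable_of_inter_nonempty [Finite α] (hN : ∀ x, (N x).Nonempty)
    (x y : V) (hxy : (N x ∩ N y).Nonempty) : (cartesianSkeleton N).Reachable x y := by
  induction hn : Nat.card α - (N x ∩ N y).ncard using Nat.strong_induction_on
    generalizing x y with
  | _ n ih =>
  by_cases hne : x = y
  · exact hne ▸ Reachable.rfl
  by_cases ha : (cartesianSkeleton N).Adj x y
  · exact ha.reachable
  have grow : ∀ a b, (N x ∩ N y) ⊂ N a ∩ N b → (cartesianSkeleton N).Reachable a b := by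
    intro a b hab
    have l₁ := Set.ncard_lt_ncard hab (Set.toFinite _)
    have l₂ := Set.ncard_le_card (N a ∩ N b)
    exact ih _ (by omega) a b (hxy.mono hab.1) rfl
  obtain ⟨z, h₁, h₂⟩ : ∃ z, HalfDispensable N x y z ∧ HalfDispensable N y x z := by
    by_contra hz
    exact ha ⟨hne, hxy, hz⟩
  rcases h₁ with h₁ | h₁
  · rcases h₂ with h₂ | h₂
    · rw [Set.inter_comm (N y) (N x)] at h₂
      exact (grow x z h₁).trans (grow y z h₂).symm
    · exact (cartesianSkeleton_reachable_of_ssubset hN x y (h₂.1.trans h₂.2)).symm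
  · exact cartesianSkeleton_reachable_of_ssubset hN y x (h₁.1.trans h₁.2)

end Skeleton

/-! ### Closed neighborhoods and skeletons of strong products -/

section StrongProduct

variable {V : Type u} {W : Type v} {G : SimpleGraph V} {H : SimpleGraph W}

theorem mem_closedNbhd {x y : V} : y ∈ G.closedNbhd x ↔ y = x ∨ G.Adj x y :=
  Iff.rfl

theorem closedNbhd_nonempty (x : V) : (G.closedNbhd x).Nonempty :=
  ⟨x, Set.mem_insert _ _⟩

theorem strongProd_adj {x y : V × W} : (G.strongProd H).Adj x y ↔
    (G.Adj x.1 y.1 ∧ x.2 = y.2 ∨ H.Adj x.2 y.2 ∧ x.1 = y.1) ∨ G.Adj x.1 y.1 ∧ H.Adj x.2 y.2 :=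
  Iff.rfl

theorem boxProd_le_strongProd : (G □ H) ≤ G.strongProd H :=
  le_sup_left

theorem closedNbhd_strongProd :
    (G.strongProd H).closedNbhd = prodNbhd G.closedNbhd H.closedNbhd := by
  ext ⟨g, h⟩ ⟨g', h'⟩
  simp only [prodNbhd, Set.mem_prod, mem_closedNbhd, strongProd_adj, Prod.mk.injEq]
  constructor
  · rintro (⟨a, b⟩ | (⟨a, b⟩ | ⟨a, b⟩) | ⟨a, b⟩)
    · exact ⟨Or.inl a, Or.inl b⟩
    · exact ⟨Or.inr a, Or.inl b.symm⟩
    · exact ⟨Or.inl b.symm, Or.inr a⟩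
    · exact ⟨Or.inr a, Or.inr b⟩
  · rintro ⟨a | a, b | b⟩
    · exact Or.inl ⟨a, b⟩
    · exact Or.inr (Or.inl (Or.inr ⟨b, a.symm⟩))
    · exact Or.inr (Or.inl (Or.inl ⟨a, b.symm⟩))
    · exact Or.inr (Or.inr ⟨a, b⟩)

theorem closedNbhd_iso {G' : SimpleGraph W} (φ : G ≃g G') (x : V) :
    G'.closedNbhd (φ x) = φ.toEquiv '' G.closedNbhd x := by
  ext y
  obtain ⟨z, rfl⟩ := φ.surjective y
  rw [show φ z = φ.toEquiv z from rfl, φ.toEquiv.injective.mem_set_image]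
  change φ z = φ x ∨ G'.Adj (φ x) (φ z) ↔ z = x ∨ G.Adj x z
  rw [φ.map_adj_iff, φ.injective.eq_iff]

theorem Connected.cartesianSkeleton_closedNbhd [Finite V] (hG : G.Connected) :
    (cartesianSkeleton G.closedNbhd).Connected := by
  have := hG.nonempty
  refine ⟨fun x y => ?_⟩
  obtain ⟨p⟩ := hG.preconnected x y
  induction p with
  | nil => exact Reachable.rfl
  | cons h _ ih =>
    exact (cartesianSkeleton_reachable_of_inter_nonempty closedNbhd_nonempty _ _
      ⟨_, Or.inr h, Or.inl rfl⟩).trans ih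

theorem cartesianSkeleton_closedNbhd_strongProd (hG : G.IsSThin) (hH : H.IsSThin) :
    cartesianSkeleton (G.strongProd H).closedNbhd =
      cartesianSkeleton G.closedNbhd □ cartesianSkeleton H.closedNbhd := by
  rw [closedNbhd_strongProd]
  exact cartesianSkeleton_prodNbhd closedNbhd_nonempty closedNbhd_nonempty
    (fun x y => hG x y) (fun x y => hH x y)

end StrongProduct

/-! ### Images of fibers under isomorphisms -/

section Fibers

variable {V V' W W' : Type*}

theorem Iso.edist_eq {G : SimpleGraph V} {G' : SimpleGraph V'} (φ : G ≃g G') (x y : V) :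
    G'.edist (φ x) (φ y) = G.edist x y := by
  apply le_antisymm
  · exact le_iInf fun p => (edist_le (p.map φ.toHom)).trans (by simp)
  · refine le_iInf fun p => ?_
    have := edist_le (p.map φ.symm.toHom)
    simpa using this

/-- Under an isomorphism of connected Cartesian products, fibers are sent to boxes. -/
theorem exists_boxProd_iso_corner {P : SimpleGraph V} {Q : SimpleGraph W}
    {P' : SimpleGraph V'} {Q' : SimpleGraph W'} (hP : P.Connected) (hQ : Q.Connected)
    (ψ : (P □ Q) ≃g (P' □ Q')) (x y : V × W) :
    ∃ z : V × W, ψ z = ((ψ x).1, (ψ y).2) ∧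
      (x.1 = y.1 → z.1 = x.1) ∧ (x.2 = y.2 → z.2 = x.2) := by
  obtain ⟨z, hz⟩ := ψ.surjective ((ψ x).1, (ψ y).2)
  -- The corner `ψ z` lies on a geodesic from `ψ x` to `ψ y`, so `z` lies on one from `x` to `y`;
  -- with the triangle inequality this holds in each coordinate.
  have key : (P □ Q).edist x z + (P □ Q).edist z y = (P □ Q).edist x y := by
    rw [← ψ.edist_eq, ← ψ.edist_eq z, ← ψ.edist_eq x y, hz]
    simp [edist_boxProd, add_comm]
  have nP : ∀ a b, P.edist a b ≠ ⊤ := fun a b => edist_ne_top_iff_reachable.2 (hP.preconnected a b)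
  have nQ : ∀ a b, Q.edist a b ≠ ⊤ := fun a b => edist_ne_top_iff_reachable.2 (hQ.preconnected a b)
  have tP := P.edist_triangle (u := x.1) (v := z.1) (w := y.1)
  have tQ := Q.edist_triangle (u := x.2) (v := z.2) (w := y.2)
  simp only [edist_boxProd] at key
  obtain ⟨a₁, e₁⟩ := ENat.ne_top_iff_exists.1 (nP x.1 z.1)
  obtain ⟨a₂, e₂⟩ := ENat.ne_top_iff_exists.1 (nP z.1 y.1)
  obtain ⟨a₃, e₃⟩ := ENat.ne_top_iff_exists.1 (nP x.1 y.1)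
  obtain ⟨b₁, f₁⟩ := ENat.ne_top_iff_exists.1 (nQ x.2 z.2)
  obtain ⟨b₂, f₂⟩ := ENat.ne_top_iff_exists.1 (nQ z.2 y.2)
  obtain ⟨b₃, f₃⟩ := ENat.ne_top_iff_exists.1 (nQ x.2 y.2)
  rw [← e₁, ← e₂, ← e₃, ← f₁, ← f₂, ← f₃] at key
  rw [← e₁, ← e₂, ← e₃] at tP
  rw [← f₁, ← f₂, ← f₃] at tQ
  norm_cast at key tP tQ
  refine ⟨z, hz, fun h => ?_, fun h => ?_⟩
  · rw [h, edist_self] at e₃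
    have : a₃ = 0 := by exact_mod_cast e₃
    have : a₁ = 0 := by omega
    subst this
    exact (edist_eq_zero_iff.1 (e₁.symm.trans (by simp))).symm
  · rw [h, edist_self] at f₃
    have : b₃ = 0 := by exact_mod_cast f₃
    have : b₁ = 0 := by omega
    subst this
    exact (edist_eq_zero_iff.1 (f₁.symm.trans (by simp))).symm

end Fibers

/-- A prime graph embedded in a strong product as a box lies in a single fiber. -/
theorem IsStrongPrime.const_of_box {V : Type u} {α β : Type*} {G : SimpleGraph V}
    (hG : G.IsStrongPrime) {P : SimpleGraph α} {Q : SimpleGraph β} (ι : G ↪g P.strongProd Q)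
    (box : ∀ a b, ∃ c, ι c = ((ι a).1, (ι b).2)) :
    (∀ a b, (ι a).1 = (ι b).1) ∨ (∀ a b, (ι a).2 = (ι b).2) := by
  by_contra! hcon
  obtain ⟨⟨a, b, hab⟩, a', b', hab'⟩ := hcon
  let A : Set α := Set.range fun v => (ι v).1
  let B : Set β := Set.range fun v => (ι v).2
  let f : V → A := fun v => ⟨(ι v).1, v, rfl⟩
  let f' : V → B := fun v => ⟨(ι v).2, v, rfl⟩
  -- `Shrink` brings the projections back into universe `u`, where primeness is stated.
  let e : V → Shrink.{u} A × Shrink.{u} B := fun v => (equivShrink A (f v), equivShrink B (f' v))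
  have e_fst : ∀ v w, (e v).1 = (e w).1 ↔ (ι v).1 = (ι w).1 := fun v w =>
    (equivShrink A).injective.eq_iff.trans Subtype.ext_iff
  have e_snd : ∀ v w, (e v).2 = (e w).2 ↔ (ι v).2 = (ι w).2 := fun v w =>
    (equivShrink B).injective.eq_iff.trans Subtype.ext_iff
  have he : Function.Bijective e := by
    constructor
    · intro v w h
      exact ι.injective (Prod.ext ((e_fst v w).1 (congrArg Prod.fst h))
        ((e_snd v w).1 (congrArg Prod.snd h)))
    · rintro ⟨s, t⟩
      obtain ⟨⟨_, v, rfl⟩, rfl⟩ := (equivShrink A).surjective s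
      obtain ⟨⟨_, w, rfl⟩, rfl⟩ := (equivShrink B).surjective t
      obtain ⟨c, hc⟩ := box v w
      exact ⟨c, by simp [e, f, f', hc]⟩
  refine hG.2 ⟨Shrink A, Shrink B, P.comap fun s => ((equivShrink A).symm s : α),
    Q.comap fun s => ((equivShrink B).symm s : β), ⟨(e a).1, (e b).1, mt (e_fst a b).1 hab⟩,
    ⟨(e a').2, (e b').2, mt (e_snd a' b').1 hab'⟩, ⟨Equiv.ofBijective e he, ?_⟩⟩
  intro v w
  rw [← ι.map_adj_iff]
  simp only [Equiv.ofBijective_apply, strongProd_adj, e_fst, e_snd]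
  simp [e, f, f']

/-! ### Automorphisms of strong products of primes -/

section Automorphisms

variable {V : Type u} {W : Type v} {G : SimpleGraph V} {H : SimpleGraph W}

/-- The fiber of the strong product parallel to the first factor. -/
def strongProdLeft (G : SimpleGraph V) (H : SimpleGraph W) (h : W) : G ↪g G.strongProd H where
  toFun g := (g, h)
  inj' _ _ k := congrArg Prod.fst k
  map_rel_iff' := by
    intro a b
    change (G.strongProd H).Adj (a, h) (b, h) ↔ _
    simp [strongProd_adj]

/-- The fiber of the strong product parallel to the second factor. -/
def strongProdRight (G : SimpleGraph V) (H : SimpleGraph W) (g : V) : H ↪g G.strongProd H where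
  toFun h := (g, h)
  inj' _ _ k := congrArg Prod.snd k
  map_rel_iff' := by
    intro a b
    change (G.strongProd H).Adj (g, a) (g, b) ↔ _
    simp [strongProd_adj]

theorem boxProd_adj_of_strongProd_adj {x y : V × W} (h : (G.strongProd H).Adj x y)
    (e : x.1 = y.1 ∨ x.2 = y.2) : (G □ H).Adj x y := by
  rcases h with h | ⟨h₁, h₂⟩
  · exact h
  · rcases e with e | e
    · exact absurd e h₁.ne
    · exact absurd e h₂.ne

/-- Automorphisms of a strong product of two `S`-thin prime connected finite graphs preserve
Cartesian edges. -/
theorem boxProd_adj_map_of_prime [Finite V] [Finite W] (cG : G.Connected) (cH : H.Connected)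
    (tG : G.IsSThin) (tH : H.IsSThin) (pG : G.IsStrongPrime) (pH : H.IsStrongPrime)
    (φ : G.strongProd H ≃g G.strongProd H) {x y : V × W} (hxy : (G □ H).Adj x y) :
    (G □ H).Adj (φ x) (φ y) := by
  have corner : ∀ x y : V × W, ∃ z : V × W, φ z = ((φ x).1, (φ y).2) ∧
      (x.1 = y.1 → z.1 = x.1) ∧ (x.2 = y.2 → z.2 = x.2) := by
    let ψ := cartesianSkeletonIso φ.toEquiv φ.toEquiv (closedNbhd_iso φ)
    have hψ : ∀ x, ψ x = φ x := fun _ => rfl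
    -- Making `ψ` opaque lets its type be rewritten along the skeleton identity.
    clear_value ψ
    revert ψ
    rw [cartesianSkeleton_closedNbhd_strongProd tG tH]
    intro ψ hψ x y
    simpa only [hψ] using exists_boxProd_iso_corner cG.cartesianSkeleton_closedNbhd
      cH.cartesianSkeleton_closedNbhd ψ x y
  refine boxProd_adj_of_strongProd_adj (φ.map_adj_iff.2 (boxProd_le_strongProd hxy)) ?_
  obtain ⟨g, h⟩ := x
  obtain ⟨g', h'⟩ := y
  rcases hxy with ⟨-, e⟩ | ⟨-, e⟩ <;> simp only at e <;> subst e
  · refine (pG.const_of_box (φ.toEmbedding.comp (strongProdLeft G H h)) fun a b => ?_).imp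
      (fun k => k g g') (fun k => k g g')
    obtain ⟨⟨c, d⟩, hc, -, hd⟩ := corner (a, h) (b, h)
    obtain rfl : d = h := hd rfl
    exact ⟨c, hc⟩
  · refine (pH.const_of_box (φ.toEmbedding.comp (strongProdRight G H g)) fun a b => ?_).imp
      (fun k => k h h') (fun k => k h h')
    obtain ⟨⟨c, d⟩, hc, hd, -⟩ := corner (g, a) (g, b)
    obtain rfl : c = g := hd rfl
    exact ⟨d, hc⟩

end Automorphisms

/-! ### Extending distinguishing labelings -/

section Labelings

variable {V : Type u} {A B : SimpleGraph V}

open Classical in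
/-- Extend a labeling of the edges of `A`, relabeled along `f`, to all edges of `B` by giving the
other edges the label `x`. -/
noncomputable def extendLabeling {d d' : ℕ} (c : A.edgeSet → Fin d) (f : Fin d → Fin d')
    (x : Fin d') (e : B.edgeSet) : Fin d' :=
  if h : (e : Sym2 V) ∈ A.edgeSet then f (c ⟨e, h⟩) else x

/-- A label-preserving automorphism of `B` is also one of `A`, and injectivity of `f` recovers the
labels of `c`. -/
theorem IsEdgeDistinguishing.extendLabeling (hAB : A ≤ B) {d d' : ℕ} {c : A.edgeSet → Fin d}
    (hc : A.IsEdgeDistinguishing c) {f : Fin d → Fin d'} (hf : Function.Injective f) {x : Fin d'}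
    (hpres : ∀ φ : B ≃g B,
      (∀ e : B.edgeSet, extendLabeling c f x (φ.mapEdgeSet e) = extendLabeling c f x e) →
        ∀ u v, A.Adj u v ↔ A.Adj (φ u) (φ v)) :
    B.IsEdgeDistinguishing (extendLabeling c f x) := by
  intro φ hφ
  let φ' : A ≃g A := ⟨φ.toEquiv, fun {u v} => (hpres φ hφ u v).symm⟩
  refine hc φ' fun ⟨e, he⟩ => hf ?_
  have key := hφ ⟨e, edgeSet_mono hAB he⟩
  have he' : ((φ.mapEdgeSet ⟨e, edgeSet_mono hAB he⟩ : B.edgeSet) : Sym2 V) ∈ A.edgeSet :=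
    (φ'.mapEdgeSet ⟨e, he⟩).2
  rw [SimpleGraph.extendLabeling, SimpleGraph.extendLabeling, dif_pos he', dif_pos he] at key
  exact key

theorem distinguishingIndex_le {d : ℕ} (hd : 1 ≤ d) {c : A.edgeSet → Fin d}
    (hc : A.IsEdgeDistinguishing c) : A.distinguishingIndex ≤ d :=
  sInf_le ⟨d, hd, rfl, c, hc⟩

theorem exists_isEdgeDistinguishing (h : A.distinguishingIndex ≠ ⊤) :
    ∃ d : ℕ, 1 ≤ d ∧ A.distinguishingIndex = d ∧
      ∃ c : A.edgeSet → Fin d, A.IsEdgeDistinguishing c := by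
  refine csInf_mem (s := {n : ℕ∞ | ∃ d : ℕ, 1 ≤ d ∧ n = (d : ℕ∞) ∧
    ∃ c : A.edgeSet → Fin d, A.IsEdgeDistinguishing c}) ?_
  by_contra hs
  rw [Set.not_nonempty_iff_eq_empty] at hs
  exact h (by rw [distinguishingIndex, hs, sInf_empty])

/-- One additional label suffices to pass to a larger graph on the same vertices. -/
theorem distinguishingIndex_le_add_one (hAB : A ≤ B) :
    B.distinguishingIndex ≤ A.distinguishingIndex + 1 := by
  by_cases h : A.distinguishingIndex = ⊤
  · simp [h]
  obtain ⟨d, hd, e, c, hc⟩ := exists_isEdgeDistinguishing h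
  rw [e]
  refine (distinguishingIndex_le (d := d + 1) (by omega)
    (hc.extendLabeling hAB (Fin.castSucc_injective d) (x := Fin.last d) ?_)).trans (by simp)
  intro φ hφ u v
  have mem : ∀ e : B.edgeSet, (e : Sym2 V) ∈ A.edgeSet ↔
      extendLabeling c Fin.castSucc (Fin.last d) e ≠ Fin.last d := by
    intro e
    by_cases k : (e : Sym2 V) ∈ A.edgeSet
    · simp [extendLabeling, k, Fin.castSucc_ne_last]
    · simp [extendLabeling, k]
  have edge : ∀ k : B.Adj u v, A.Adj u v ↔ A.Adj (φ u) (φ v) := by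
    intro k
    have h₁ := mem ⟨s(u, v), k⟩
    have h₂ := mem (φ.mapEdgeSet ⟨s(u, v), k⟩)
    rw [hφ, ← h₁] at h₂
    exact h₂.symm
  exact ⟨fun k => (edge (hAB k)).1 k, fun k => (edge (φ.map_adj_iff.1 (hAB k))).2 k⟩

/-- If automorphisms of the larger graph preserve the smaller one, then no additional label is
needed. -/
theorem distinguishingIndex_le_of_map_adj (hAB : A ≤ B)
    (hpres : ∀ (φ : B ≃g B) (u v : V), A.Adj u v → A.Adj (φ u) (φ v)) :
    B.distinguishingIndex ≤ A.distinguishingIndex := by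
  by_cases h : A.distinguishingIndex = ⊤
  · simp [h]
  obtain ⟨d, hd, e, c, hc⟩ := exists_isEdgeDistinguishing h
  rw [e]
  -- The label `0` of the added edges is arbitrary; `hd` makes it exist.
  refine distinguishingIndex_le hd
    (hc.extendLabeling hAB Function.injective_id (x := ⟨0, hd⟩) fun φ _ u v => ⟨hpres φ u v, ?_⟩)
  intro k
  simpa using hpres φ.symm _ _ k

end Labelings

end SimpleGraph

theorem theorem3p3 {V : Type u} {W : Type v} (G : SimpleGraph V) (H : SimpleGraph W) :
    (G.Connected → H.Connected →
      (G.strongProd H).distinguishingIndex ≤ (G □ H).distinguishingIndex + 1) ∧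
    (Finite V → Finite W → G.Connected → H.Connected →
      G.IsSThin → H.IsSThin → G.IsStrongPrime → H.IsStrongPrime →
      (G.strongProd H).distinguishingIndex ≤ (G □ H).distinguishingIndex) := by
  refine ⟨fun _ _ => SimpleGraph.distinguishingIndex_le_add_one SimpleGraph.boxProd_le_strongProd,
    fun _ _ cG cH tG tH pG pH => ?_⟩
  exact SimpleGraph.distinguishingIndex_le_of_map_adj SimpleGraph.boxProd_le_strongProd
    fun φ _ _ h => SimpleGraph.boxProd_adj_map_of_prime cG cH tG tH pG pH φ h
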